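/- All Banach spaces are over a fixed scalar field $\mathbb K\in\{\mathbb R,\mathbb C\}$, operators are bounded and linear, and subspaces are closed. An operator $S\colon W\to Z$ *factors through* $T\colon X\to Y$ if $S=VTU$ for some operators $U\colon W\to X$, $V\colon Y\to Z$. For a class $\mathscr C$ of operators between Banach spaces, $\Upsilon$ is *universal for* $\mathscr C$ if $\Upsilon\in\mathscr C$ and $\Upsilon$ factors through every member of $\mathscr C$. Let $\mathscr X^*$ be the class of operators $T$ whose adjoint $T^*$ has norm-separable range, and $\complement\mathscr X^*$ its complement. An operator $T\colon X\to Y$ is *Asplund* if $T|_Z\in\mathscr X^*$ for every separable subspace $Z\subseteq X$. Let $\Omega$ be the set of all finite (possibly empty) sequences of natural numbers, ordered by $s\sqsubseteq t$ iff $s$ is an initial segment of $t$, and let $\mathcal D\subseteq\Omega$ be the infinite dyadic tree of finite sequences in $\{0,1\}$. For a downwards closed $\mathcal T\subseteq\Omega$ let $\partial\mathcal T$ be the set of infinite branches (infinite maximal chains) of $\mathcal T$ and $\overline{\mathcal T}=\mathcal T\cup\partial\mathcal T$, ordered by $\sqsubseteq'$, which extends $\sqsubseteq$ on $\mathcal T$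 by: $s\sqsubseteq' b$ iff $s\in b$ or $s=b$, for $b\in\partial\mathcal T$. Give $\overline{\mathcal T}$ its coarse wedge topology, whose subbase consists of the sets $\{s\in\overline{\mathcal T}: t\sqsubseteq' s\}$ and their complements, where $t$ ranges over the elements of $\overline{\mathcal T}$ whose set of strict predecessors is empty or has a greatest element; it is compact. Define $$\Sigma_{\mathcal T}\colon\ell_1(\mathcal T)\to\ell_\infty(\mathcal T),\quad (\Sigma_{\mathcal T}x)(t)=\sum_{s\sqsubseteq t}x(s),\qquad \sigma_{\mathcal T}\colon\ell_1(\mathcal T)\to C(\overline{\mathcal T}),\quad (\sigma_{\mathcal T}x)(t)=\sum_{s\in\mathcal T,\ s\sqsubseteq' t}x(s).$$ **Theorem.** Let $X,Y$ be Banach spaces, $T\colon X\to Y$ an operator such that $T^*(Y^*)$ is non-separable, and $\mathcal T\subseteq\Omega$ downwards closed. 1. If $X$ is separable, then $\Sigma_{\mathcal T}$ factors through $T$. 2. If $Y$ is separable, then $\sigma_{\mathcal T}$ factors through $T$, and hence so does $\Sigma_{\mathcal T}$. If $\mathcal S\subseteq\Omega$ is downwards closed and $\partial\mathcal S$ is uncountable,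 then: 3. $\Sigma_{\mathcal S}$ is universal for the class of non-Asplund operators. 4. $\sigma_{\mathcal S}$ is universal for the class of operators in $\complement\mathscr X^*$ having separable codomain, and this class coincides with the class of non-Asplund operators having separable codomain. In particular, $\partial\mathcal S$ is uncountable and (3) and (4) hold for $\mathcal S=\Omega$ and for $\mathcal S=\mathcal D$. -/

import Mathlib

open scoped ENNReal

universe w u v u₁ v₁

namespace TreeOperators


/-! ### Trees of finite sequences -/

/-- The set of all finite (possibly empty) sequences of natural numbers. -/
def Omega : Type := List ℕ

/-- `s ≤ t` means that `s` is an initial segment of `t`. -/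
instance : PartialOrder Omega where
  le s t := List.IsPrefix s t
  le_refl s := List.prefix_refl s
  le_trans _ _ _ h₁ h₂ := List.IsPrefix.trans h₁ h₂
  le_antisymm _ _ h₁ h₂ := h₁.eq_of_length (le_antisymm h₁.length_le h₂.length_le)

theorem Omega.le_def {s t : Omega} : s ≤ t ↔ List.IsPrefix s t := Iff.rfl

theorem Omega.total_of_le {s t u : Omega} (hs : s ≤ u) (ht : t ≤ u) : s ≤ t ∨ t ≤ s :=
  List.prefix_or_prefix_of_prefix hs ht

theorem Omega.finite_Iic (t : Omega) : (Set.Iic t).Finite :=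
  (List.finite_toSet (List.inits t)).subset fun _ hs => (List.mem_inits _ _).2 hs

/-- The infinite dyadic tree: all finite sequences in `{0, 1}`. -/
def dyadicTree : LowerSet Omega where
  carrier := {t | ∀ n ∈ (show List ℕ from t), n = 0 ∨ n = 1}
  lower' := fun _ _ hst ht n hn => ht n (List.IsPrefix.subset hst hn)

/-- The set of all infinite branches (infinite maximal chains) of a downwards closed tree. -/
def boundary (T : LowerSet Omega) : Set (Set T) :=
  {b | IsMaxChain (· ≤ ·) b ∧ b.Infinite}

theorem boundary.mem_of_le {T : LowerSet Omega} {b : Set T} (hb : b ∈ boundary T) {s t : T}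
    (hst : s ≤ t) (ht : t ∈ b) : s ∈ b := by
  have hc : IsChain (· ≤ ·) (insert s b) := by
    refine hb.1.1.insert fun c hc _ => ?_
    rcases hb.1.1.total ht hc with h | h
    · exact Or.inl (hst.trans h)
    · exact Omega.total_of_le (u := (t : Omega)) hst h
  rw [hb.1.2 hc (Set.subset_insert s b)]
  exact Set.mem_insert s b

/-- The union of a downwards closed tree with its set of infinite branches. -/
inductive Completion (T : LowerSet Omega) : Type
  | node (t : T) : Completion T
  | branch (b : boundary T) : Completion T

namespace Completion

variable {T : LowerSet Omega}

/-- The extended order: nodes are compared as in the tree, a node lies below a branch when it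
belongs to it, and distinct branches are incomparable. -/
protected def le : Completion T → Completion T → Prop
  | node s, node t => s ≤ t
  | node s, branch b => s ∈ b.1
  | branch _, node _ => False
  | branch b, branch c => b = c

instance : PartialOrder (Completion T) where
  le := Completion.le
  le_refl a := by cases a <;> simp [Completion.le]
  le_trans a b c hab hbc := by
    cases a <;> cases b <;> cases c <;> simp only [Completion.le] at hab hbc ⊢
    · exact hab.trans hbc
    · exact boundary.mem_of_le (Subtype.property _) hab hbc
    · exact hbc ▸ hab
    · exact hab.trans hbc
  le_antisymm a b hab hba := by
    cases a <;> cases b <;> simp only [Completion.le] at hab hba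
    · rw [le_antisymm hab hba]
    · rw [hab]

@[simp] theorem node_le_node {s t : T} : node s ≤ node t ↔ s ≤ t := Iff.rfl

@[simp] theorem node_le_branch {s : T} {b : boundary T} : node s ≤ branch b ↔ s ∈ b.1 := Iff.rfl

@[simp] theorem not_branch_le_node {s : T} {b : boundary T} : ¬ branch b ≤ node s := fun h => h

@[simp] theorem branch_le_branch {b c : boundary T} : branch b ≤ branch c ↔ b = c := Iff.rfl

end Completion

/-! ### The coarse wedge topology -/

/-- The set of predecessors of `t` is empty or has a greatest element; in a tree this says that
its order type is `0` or a successor ordinal. -/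
def IsNonLimit {α : Type*} [PartialOrder α] (t : α) : Prop :=
  Set.Iio t = ∅ ∨ ∃ p, IsGreatest (Set.Iio t) p

/-- The coarse wedge topology, with subbase the sets `{s | t ≤ s}` and their complements, `t` non-limit. -/
@[reducible] def coarseWedge (α : Type*) [PartialOrder α] : TopologicalSpace α :=
  TopologicalSpace.generateFrom
    {U | ∃ t : α, IsNonLimit t ∧ (U = Set.Ici t ∨ U = (Set.Ici t)ᶜ)}

namespace Completion

variable {T : LowerSet Omega}

instance : TopologicalSpace (Completion T) := coarseWedge (Completion T)

theorem isNonLimit_node (t : T) : IsNonLimit (node t) := by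
  by_cases h : Set.Iio (node t) = ∅
  · exact Or.inl h
  right
  have hfin : {s : T | s < t}.Finite :=
    ((Omega.finite_Iic (t : Omega)).preimage Subtype.val_injective.injOn).subset
      fun s hs => (le_of_lt hs : s ≤ t)
  have key : ∀ a : Completion T, a < node t → ∃ s : T, a = node s ∧ s < t := by
    intro a ha
    cases a with
    | node s => exact ⟨s, rfl, ⟨ha.1, ha.2⟩⟩
    | branch b => exact absurd ha.1 not_branch_le_node
  obtain ⟨a, ha⟩ := Set.nonempty_iff_ne_empty.2 h
  obtain ⟨s, -, hs⟩ := key a ha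
  obtain ⟨m, hm⟩ := hfin.exists_maximal ⟨s, hs⟩
  refine ⟨node m, ⟨hm.prop.1, hm.prop.2⟩, fun a ha => ?_⟩
  obtain ⟨c, rfl, hc⟩ := key a ha
  rcases Omega.total_of_le (u := (t : Omega)) hc.le hm.prop.le with h | h
  · exact h
  · exact hm.le_of_ge hc h

theorem isNonLimit_iff (a : Completion T) : IsNonLimit a ↔ ∃ t, a = node t := by
  refine ⟨fun h => ?_, fun ⟨t, ht⟩ => ht ▸ isNonLimit_node t⟩
  cases a with
  | node t => exact ⟨t, rfl⟩
  | branch b =>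
    exfalso
    have hlt : ∀ s ∈ b.1, node s < branch b := fun s hs => ⟨hs, not_branch_le_node⟩
    rcases h with h | ⟨p, hp, hmax⟩
    · obtain ⟨s, hs⟩ := b.2.2.nonempty
      exact (Set.eq_empty_iff_forall_notMem.1 h) (node s) (hlt s hs)
    · cases p with
      | branch c => exact hp.2 (le_of_eq (congrArg branch (hp.1 : c = b).symm))
      | node p =>
        refine b.2.2 (((Omega.finite_Iic (p : Omega)).preimage
          Subtype.val_injective.injOn).subset fun s hs => ?_)
        exact (hmax (hlt s hs) : node s ≤ node p)

theorem isClopen_Ici_node (t : T) : IsClopen (Set.Ici (node t)) := by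
  constructor
  · rw [← isOpen_compl_iff]
    exact TopologicalSpace.isOpen_generateFrom_of_mem ⟨_, isNonLimit_node t, Or.inr rfl⟩
  · exact TopologicalSpace.isOpen_generateFrom_of_mem ⟨_, isNonLimit_node t, Or.inl rfl⟩

theorem le_nhds_of_forall (f : Ultrafilter (Completion T)) (a : Completion T)
    (h : ∀ s : T, node s ≤ a ↔ Set.Ici (node s) ∈ f) : (f : Filter (Completion T)) ≤ nhds a := by
  refine le_of_le_of_eq ?_ TopologicalSpace.nhds_generateFrom.symm
  refine le_iInf₂ fun U hU => ?_
  obtain ⟨haU, t, ht, hU⟩ := hU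
  obtain ⟨t, rfl⟩ := (isNonLimit_iff t).1 ht
  rw [Filter.le_principal_iff]
  rcases hU with rfl | rfl
  · exact (h t).1 haU
  · exact Ultrafilter.compl_mem_iff_notMem.2 fun hf => haU ((h t).2 hf)

instance : CompactSpace (Completion T) := by
  refine ⟨isCompact_iff_ultrafilter_le_nhds.2 fun f _ => ?_⟩
  let A : Set T := {s | Set.Ici (node s) ∈ f}
  have hAlow : ∀ s t : T, s ≤ t → t ∈ A → s ∈ A := fun s t hst ht =>
    Filter.mem_of_superset ht (Set.Ici_subset_Ici.2 hst)
  have hAchain : IsChain (· ≤ ·) A := by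
    intro s hs t ht _
    obtain ⟨a, has, hat⟩ := Filter.nonempty_of_mem (Filter.inter_mem hs ht)
    cases a with
    | node a => exact Omega.total_of_le (u := (a : Omega)) has hat
    | branch b => exact b.2.1.1.total has hat
  by_cases hfin : A.Finite
  · have hne : A.Nonempty := by
      obtain ⟨a, -⟩ := Filter.nonempty_of_mem (f := (f : Filter (Completion T))) Filter.univ_mem
      have hT : ∃ t : T, True := by
        cases a with
        | node t => exact ⟨t, trivial⟩
        | branch b => exact ⟨b.2.2.nonempty.some, trivial⟩
      obtain ⟨t, -⟩ := hT
      have hroot : (show Omega from ([] : List ℕ)) ∈ T :=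
        T.lower (show (show Omega from ([] : List ℕ)) ≤ t from List.nil_prefix) t.2
      refine ⟨⟨_, hroot⟩, Filter.mem_of_superset Filter.univ_mem fun c _ => ?_⟩
      have hle : ∀ c : T, (⟨_, hroot⟩ : T) ≤ c := fun c => List.nil_prefix
      cases c with
      | node c => exact hle c
      | branch b => exact boundary.mem_of_le b.2 (hle _) b.2.2.nonempty.some_mem
    obtain ⟨m, hm⟩ := hfin.exists_maximal hne
    refine ⟨node m, trivial, le_nhds_of_forall f _ fun s => ⟨fun h => hAlow s m h hm.prop,
      fun h => ?_⟩⟩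
    rcases hAchain.total h hm.prop with h' | h'
    · exact h'
    · exact hm.le_of_ge h h'
  · have hbr : A ∈ boundary T := by
      refine ⟨⟨hAchain, fun C hC hAC => hAC.antisymm fun c hc => ?_⟩, hfin⟩
      by_contra hcA
      refine hfin (((Omega.finite_Iic (c : Omega)).preimage
        Subtype.val_injective.injOn).subset fun s hs => ?_)
      rcases hC.total (hAC hs) hc with h | h
      · exact h
      · exact absurd (hAlow c s h hs) hcA
    exact ⟨branch ⟨A, hbr⟩, trivial, le_nhds_of_forall f _ fun s => Iff.rfl⟩

end Completion

/-! ### The summation operators -/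

section Operators

variable (𝕜 : Type w) [RCLike 𝕜]

/-- `ℓ₁(I)`. -/
abbrev EllOne (I : Type*) := lp (fun _ : I => 𝕜) 1

/-- `ℓ_∞(I)`. -/
abbrev EllInfty (I : Type*) := lp (fun _ : I => 𝕜) ∞

variable {𝕜}

theorem EllOne.summable_norm {I : Type*} (x : EllOne 𝕜 I) : Summable fun i => ‖x i‖ := by
  simpa using (lp.memℓp x).summable (by simp)

theorem EllOne.summable_subtype {I : Type*} (x : EllOne 𝕜 I) (A : Set I) :
    Summable fun i : A => x i :=
  ((EllOne.summable_norm x).subtype A).of_norm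

theorem EllOne.norm_tsum_le {I : Type*} (x : EllOne 𝕜 I) (A : Set I) :
    ‖∑' i : A, x i‖ ≤ ‖x‖ := by
  have h : ‖x‖ = ∑' i, ‖x i‖ := by
    simpa using lp.norm_eq_tsum_rpow (p := 1) (by simp) x
  rw [h]
  exact (norm_tsum_le_tsum_norm ((EllOne.summable_norm x).subtype A)).trans
    (Summable.tsum_subtype_le (fun i => ‖x i‖) A (fun i => norm_nonneg _)
      (EllOne.summable_norm x))

variable (𝕜)

/-- The operator `ℓ₁(α) → ℓ_∞(α)`, `x ↦ (∑_{s ≤ t} x s)_t`. -/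
noncomputable def bigSigma (α : Type*) [PartialOrder α] : EllOne 𝕜 α →L[𝕜] EllInfty 𝕜 α :=
  LinearMap.mkContinuous
    { toFun := fun x => ⟨fun t => ∑' s : Set.Iic t, x s, memℓp_infty
        ⟨‖x‖, by rintro _ ⟨t, rfl⟩; exact EllOne.norm_tsum_le x _⟩⟩
      map_add' := fun x y => by
        ext t
        exact (EllOne.summable_subtype x _).tsum_add (EllOne.summable_subtype y _)
      map_smul' := fun c x => by
        ext t
        exact tsum_mul_left }
    1 fun x => by
      rw [one_mul]
      exact lp.norm_le_of_forall_le (norm_nonneg _) fun t => EllOne.norm_tsum_le x _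

variable {𝕜}

theorem continuous_tsum_le {T : LowerSet Omega} (x : EllOne 𝕜 T) :
    Continuous fun t : Completion T => ∑' s : {s : T | Completion.node s ≤ t}, x s := by
  have h : (fun t : Completion T => ∑' s : {s : T | Completion.node s ≤ t}, x s) =
      fun t => ∑' s : T, (Set.Ici (Completion.node s)).indicator (fun _ => x s) t := by
    funext t
    rw [tsum_subtype]
    rfl
  rw [h]
  refine continuous_tsum (fun s => ?_) (EllOne.summable_norm x) fun s t => ?_
  · exact continuous_const.indicator (by
      rw [(Completion.isClopen_Ici_node s).frontier_eq]; simp)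
  · exact norm_indicator_le_norm_self _ _

variable (𝕜)

/-- The operator `ℓ₁(T) → C(T ∪ ∂T)`, `x ↦ (t ↦ ∑_{s ∈ T, s ≤ t} x s)`. -/
noncomputable def smallSigma (T : LowerSet Omega) : EllOne 𝕜 T →L[𝕜] C(Completion T, 𝕜) :=
  LinearMap.mkContinuous
    { toFun := fun x =>
        ⟨fun t => ∑' s : {s : T | Completion.node s ≤ t}, x s, continuous_tsum_le x⟩
      map_add' := fun x y => by
        ext t
        exact (EllOne.summable_subtype x _).tsum_add (EllOne.summable_subtype y _)
      map_smul' := fun c x => by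
        ext t
        exact tsum_mul_left }
    1 fun x => by
      rw [one_mul]
      exact (ContinuousMap.norm_le _ (norm_nonneg _)).2 fun t => EllOne.norm_tsum_le x _

/-! ### Classes of operators -/

variable {𝕜}

/-- `S` factors through `T`: `S = V T U` for some bounded operators `U`, `V`. -/
def FactorsThrough {W Z X Y : Type*}
    [NormedAddCommGroup W] [NormedSpace 𝕜 W] [NormedAddCommGroup Z] [NormedSpace 𝕜 Z]
    [NormedAddCommGroup X] [NormedSpace 𝕜 X] [NormedAddCommGroup Y] [NormedSpace 𝕜 Y]
    (S : W →L[𝕜] Z) (T : X →L[𝕜] Y) : Prop :=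
  ∃ (U : W →L[𝕜] X) (V : Y →L[𝕜] Z), V ∘L T ∘L U = S

/-- The adjoint `T* : Y* → X*`, `f ↦ f ∘ T`, has norm-separable range. -/
def HasSeparableAdjointRange {X Y : Type*}
    [NormedAddCommGroup X] [NormedSpace 𝕜 X] [NormedAddCommGroup Y] [NormedSpace 𝕜 Y]
    (T : X →L[𝕜] Y) : Prop :=
  TopologicalSpace.IsSeparable
    (Set.range fun f : StrongDual 𝕜 Y => (f ∘L T : StrongDual 𝕜 X))

/-- `T` is Asplund: the restriction of `T` to every separable closed subspace has an adjoint
with separable range. -/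
def IsAsplund {X Y : Type*}
    [NormedAddCommGroup X] [NormedSpace 𝕜 X] [NormedAddCommGroup Y] [NormedSpace 𝕜 Y]
    (T : X →L[𝕜] Y) : Prop :=
  ∀ Z : Submodule 𝕜 X, IsClosed (Z : Set X) → TopologicalSpace.SeparableSpace Z →
    HasSeparableAdjointRange (T ∘L Z.subtypeL)

/-- `S` is non-Asplund and factors through every non-Asplund operator between Banach spaces. -/
def IsUniversalNonAsplund {W : Type u₁} {Z : Type v₁}
    [NormedAddCommGroup W] [NormedSpace 𝕜 W] [NormedAddCommGroup Z] [NormedSpace 𝕜 Z]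
    (S : W →L[𝕜] Z) : Prop :=
  ¬ IsAsplund S ∧
    ∀ (X : Type u) (Y : Type v)
      [NormedAddCommGroup X] [NormedSpace 𝕜 X] [CompleteSpace X]
      [NormedAddCommGroup Y] [NormedSpace 𝕜 Y] [CompleteSpace Y]
      (T : X →L[𝕜] Y), ¬ IsAsplund T → FactorsThrough S T

/-- `S` is universal for the non-Asplund operators with separable codomain. -/
def IsUniversalNonAsplundSepCodomain {W : Type u₁} {Z : Type v₁}
    [NormedAddCommGroup W] [NormedSpace 𝕜 W] [NormedAddCommGroup Z] [NormedSpace 𝕜 Z]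
    (S : W →L[𝕜] Z) : Prop :=
  (¬ IsAsplund S ∧ TopologicalSpace.SeparableSpace Z) ∧
    ∀ (X : Type u) (Y : Type v)
      [NormedAddCommGroup X] [NormedSpace 𝕜 X] [CompleteSpace X]
      [NormedAddCommGroup Y] [NormedSpace 𝕜 Y] [CompleteSpace Y]
      (T : X →L[𝕜] Y), ¬ IsAsplund T → TopologicalSpace.SeparableSpace Y → FactorsThrough S T

/-- `S` is universal for the operators that have separable codomain and whose adjoint has
non-separable range. -/
def IsUniversalNonSepAdjointSepCodomain {W : Type u₁} {Z : Type v₁}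
    [NormedAddCommGroup W] [NormedSpace 𝕜 W] [NormedAddCommGroup Z] [NormedSpace 𝕜 Z]
    (S : W →L[𝕜] Z) : Prop :=
  (¬ HasSeparableAdjointRange S ∧ TopologicalSpace.SeparableSpace Z) ∧
    ∀ (X : Type u) (Y : Type v)
      [NormedAddCommGroup X] [NormedSpace 𝕜 X] [CompleteSpace X]
      [NormedAddCommGroup Y] [NormedSpace 𝕜 Y] [CompleteSpace Y]
      (T : X →L[𝕜] Y), ¬ HasSeparableAdjointRange T → TopologicalSpace.SeparableSpace Y →
        FactorsThrough S T

variable (𝕜)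

/-- The universality assertions for the two operators of a tree `S`. -/
def UniversalityFor (S : LowerSet Omega) : Prop :=
  IsUniversalNonAsplund.{w, u, v} (bigSigma 𝕜 S) ∧
  IsUniversalNonSepAdjointSepCodomain.{w, u, v} (smallSigma 𝕜 S) ∧
  IsUniversalNonAsplundSepCodomain.{w, u, v} (smallSigma 𝕜 S)

end Operators

end TreeOperators

open TopologicalSpace TreeOperators

/-!
Suppose that `Y` is separable, so that the unit ball of `Y*` is weak* metrizable. As its image under
`T*` is not separable, the ball contains a set `A` each relatively weak* open part of which has an
image that, for a fixed `δ > 0`, is not within `δ` of any separable set. One enumerates the tree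
with parents first and chooses functionals `β s ∈ A` and vectors `x s ∈ X` recursively: `T* (β s)`
is at distance more than `δ` from the span of its predecessors, hence `x s` may be taken of norm at
most `δ⁻¹`, with `β s (T (x s)) = 1`, and annihilated by the earlier `T* (β t)`; moreover `β s` is
weak* close to the functional of its parent. Therefore `β t (T (x s))` is almost `1` for `s ≤ t`
and almost `0` otherwise.

The vectors `x s` define an operator `ℓ₁(𝒯) → X`. The functionals `β t` define one from `Y` to
`ℓ_∞(𝒯)`, and closeness of `β t` to its parent on a dense sequence of `Y` brings its values into
`C(𝒯 ∪ ∂𝒯)`: a function on the nodes whose increments are summable extends continuously to the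
branches. The composition is a small perturbation of `σ`, measured by the increment functionals,
which are biorthogonal to the images under `σ` of the unit vectors, so that an invertible operator
on `C(𝒯 ∪ ∂𝒯)` corrects it. For separable `X` one passes to the range of `T` and uses the
injectivity of `ℓ_∞`.

Conversely, evaluations at distinct branches have adjoint images at distance at least `1`, so
uncountably many branches keep `σ` and `Σ` out of the class of operators whose adjoint has separable
range.
-/

namespace TreeOperators

/-! ### Condensation in non-separable images -/

section Condensation

variable {B M : Type*} [PseudoMetricSpace M]

/-- `S` lies in the closed `δ`-neighbourhood of a separable set. -/
def IsNearSeparable (δ : ℝ) (S : Set M) : Prop :=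
  ∃ D, IsSeparable D ∧ ∀ x ∈ S, ∃ g ∈ D, dist x g ≤ δ

theorem IsNearSeparable.mono {δ : ℝ} {S S' : Set M} (h : IsNearSeparable δ S') (hS : S ⊆ S') :
    IsNearSeparable δ S :=
  let ⟨D, hD, hDS⟩ := h
  ⟨D, hD, fun x hx => hDS x (hS hx)⟩

theorem IsNearSeparable.union {δ : ℝ} {S S' : Set M} (h : IsNearSeparable δ S)
    (h' : IsNearSeparable δ S') : IsNearSeparable δ (S ∪ S') := by
  obtain ⟨D, hD, hDS⟩ := h
  obtain ⟨D', hD', hDS'⟩ := h'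
  refine ⟨D ∪ D', hD.union hD', ?_⟩
  rintro x (hx | hx)
  · obtain ⟨g, hg, hxg⟩ := hDS x hx
    exact ⟨g, Or.inl hg, hxg⟩
  · obtain ⟨g, hg, hxg⟩ := hDS' x hx
    exact ⟨g, Or.inr hg, hxg⟩

theorem IsNearSeparable.iUnion {ι : Sort*} [Countable ι] {δ : ℝ} {S : ι → Set M}
    (h : ∀ i, IsNearSeparable δ (S i)) : IsNearSeparable δ (⋃ i, S i) := by
  choose D hD hDS using h
  refine ⟨⋃ i, D i, IsSeparable.iUnion hD, fun x hx => ?_⟩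
  obtain ⟨i, hi⟩ := Set.mem_iUnion.1 hx
  obtain ⟨g, hg, hxg⟩ := hDS i x hi
  exact ⟨g, Set.mem_iUnion.2 ⟨i, hg⟩, hxg⟩

theorem isSeparable_of_forall_isNearSeparable {S : Set M} (h : ∀ δ > 0, IsNearSeparable δ S) :
    IsSeparable S := by
  choose D hD hDS using fun n : ℕ => h (1 / ((n : ℝ) + 1)) Nat.one_div_pos_of_nat
  refine (IsSeparable.iUnion hD).closure.mono fun x hx => Metric.mem_closure_iff.2 fun ε hε => ?_
  obtain ⟨n, hn⟩ := exists_nat_one_div_lt hε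
  obtain ⟨g, hg, hxg⟩ := hDS n x hx
  exact ⟨g, Set.mem_iUnion.2 ⟨n, hg⟩, hxg.trans_lt hn⟩

variable [TopologicalSpace B]

/-- The analogue of perfectness for separability instead of countability: every non-empty
relatively open part of `A` has, for each separable set `F`, a point that `R` maps to distance
more than `δ` from all of `F`. -/
def IsNowhereNearSeparable (R : B → M) (δ : ℝ) (A : Set B) : Prop :=
  ∀ U, IsOpen U → (U ∩ A).Nonempty → ∀ F, IsSeparable F → ∃ a ∈ U ∩ A, ∀ g ∈ F, δ < dist (R a) g

theorem exists_isNowhereNearSeparable [SecondCountableTopology B] {R : B → M}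
    (hR : ¬ IsSeparable (Set.range R)) :
    ∃ δ > 0, ∃ A : Set B, A.Nonempty ∧ IsNowhereNearSeparable R δ A := by
  obtain ⟨δ, hδ, hRδ⟩ : ∃ δ > 0, ¬ IsNearSeparable δ (Set.range R) := by
    contrapose! hR
    exact isSeparable_of_forall_isNearSeparable hR
  let A : Set B := {b | ∀ V ∈ nhds b, ¬ IsNearSeparable δ (R '' V)}
  have hAc : IsNearSeparable δ (R '' Aᶜ) := by
    have hV : ∀ b ∈ Aᶜ, ∃ V ∈ nhds b, IsNearSeparable δ (R '' V) := fun b hb => by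
      simpa [A] using hb
    choose! V hVb hV using hV
    obtain ⟨t, htA, ht, hcover⟩ := countable_cover_nhdsWithin
      fun b hb => mem_nhdsWithin_of_mem_nhds (hVb b hb)
    have := ht.to_subtype
    refine (IsNearSeparable.iUnion fun b : t => hV b (htA b.2)).mono ?_
    rw [← Set.image_iUnion, ← Set.biUnion_eq_iUnion t fun b _ => V b]
    exact Set.image_mono hcover
  have hfar : ∀ V, ¬ IsNearSeparable δ (R '' V) → ∀ F, IsSeparable F →
      ∃ a ∈ V ∩ A, ∀ g ∈ F, δ < dist (R a) g := fun V hV F hF => by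
    contrapose! hV
    have hVA : IsNearSeparable δ (R '' (V ∩ A)) := ⟨F, hF, Set.forall_mem_image.2 hV⟩
    refine (hVA.union hAc).mono ?_
    rw [← Set.image_union]
    exact Set.image_mono fun b hb => (em (b ∈ A)).imp (And.intro hb) id
  refine ⟨δ, hδ, A, ?_, fun U hU ⟨b, hbU, hbA⟩ => hfar U (hbA U (hU.mem_nhds hbU))⟩
  obtain ⟨a, ha, -⟩ := hfar Set.univ (by rwa [Set.image_univ]) ∅ Set.finite_empty.isSeparable
  exact ⟨a, ha.2⟩

end Condensation

theorem isSeparable_range_of_isSeparable_image_closedBall {𝕜 E F : Type*}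
    [NontriviallyNormedField 𝕜] [SeparableSpace 𝕜]
    [SeminormedAddCommGroup E] [NormedSpace 𝕜 E] [SeminormedAddCommGroup F] [NormedSpace 𝕜 F]
    (φ : E →ₗ[𝕜] F) (h : IsSeparable (φ '' Metric.closedBall 0 1)) : IsSeparable (Set.range φ) := by
  have htop : Submodule.span 𝕜 (Metric.closedBall (0 : E) 1) = ⊤ :=
    Submodule.eq_top_of_nonempty_interior' _ ⟨0, mem_interior.2 ⟨Metric.ball 0 1,
      Metric.ball_subset_closedBall.trans Submodule.subset_span, Metric.isOpen_ball,
      Metric.mem_ball_self one_pos⟩⟩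
  rw [← LinearMap.coe_range, LinearMap.range_eq_map, ← htop, Submodule.map_span]
  exact h.span

/-! ### Functionals -/

section Functionals

variable {𝕜 : Type*} [RCLike 𝕜] {X Y : Type*}
  [NormedAddCommGroup X] [NormedSpace 𝕜 X] [NormedAddCommGroup Y] [NormedSpace 𝕜 Y]

theorem exists_mem_span_norm_sub_le {ι : Type*} [Finite ι] (L : ι → StrongDual 𝕜 X)
    (f : StrongDual 𝕜 X) {δ : ℝ} (hδ : 0 ≤ δ)
    (h : ∀ x, (∀ i, L i x = 0) → ‖f x‖ ≤ δ * ‖x‖) :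
    ∃ g ∈ Submodule.span 𝕜 (Set.range L), ‖f - g‖ ≤ δ := by
  have := Fintype.ofFinite ι
  let N : Submodule 𝕜 X := ⨅ i, LinearMap.ker (L i : X →ₗ[𝕜] 𝕜)
  have hN : ∀ x, x ∈ N ↔ ∀ i, L i x = 0 := fun x => by simp [N]
  obtain ⟨k, hkN, hk⟩ := exists_extension_norm_eq N (f ∘L N.subtypeL)
  have hker : N ≤ LinearMap.ker ((f - k : StrongDual 𝕜 X) : X →ₗ[𝕜] 𝕜) := fun x hx =>
    sub_eq_zero.2 (hkN ⟨x, hx⟩).symm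
  obtain ⟨c, hc⟩ := (Submodule.mem_span_range_iff_exists_fun 𝕜).1
    (mem_span_of_iInf_ker_le_ker hker)
  refine ⟨f - k, (Submodule.mem_span_range_iff_exists_fun 𝕜).2 ⟨c, ?_⟩, ?_⟩
  · ext x
    simpa using DFunLike.congr_fun hc x
  · rw [sub_sub_cancel, hk]
    exact ContinuousLinearMap.opNorm_le_bound _ hδ fun x => h x ((hN x).1 x.2)

theorem exists_apply_eq_one_of_forall_mem_span_lt {ι : Type*} [Finite ι]
    (L : ι → StrongDual 𝕜 X) (f : StrongDual 𝕜 X) {δ : ℝ} (hδ : 0 < δ)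
    (h : ∀ g ∈ Submodule.span 𝕜 (Set.range L), δ < ‖f - g‖) :
    ∃ x, ‖x‖ ≤ δ⁻¹ ∧ f x = 1 ∧ ∀ i, L i x = 0 := by
  obtain ⟨x, hLx, hfx⟩ : ∃ x, (∀ i, L i x = 0) ∧ δ * ‖x‖ < ‖f x‖ := by
    contrapose! h
    exact exists_mem_span_norm_sub_le L f hδ.le h
  have hpos : 0 < ‖f x‖ := (mul_nonneg hδ.le (norm_nonneg _)).trans_lt hfx
  refine ⟨(f x)⁻¹ • x, ?_, by simp [norm_pos_iff.1 hpos], fun i => by simp [hLx i]⟩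
  rw [norm_smul, norm_inv, inv_mul_le_iff₀ hpos, ← div_eq_mul_inv, le_div_iff₀' hδ]
  exact hfx.le

/-- The unit ball of the dual of `Y`, as a set of the weak-* dual. -/
def weakDualUnitBall (𝕜 Y : Type*) [RCLike 𝕜] [NormedAddCommGroup Y] [NormedSpace 𝕜 Y] :
    Set (WeakDual 𝕜 Y) :=
  WeakDual.toStrongDual ⁻¹' Metric.closedBall 0 1

instance [SeparableSpace Y] : SecondCountableTopology (weakDualUnitBall 𝕜 Y) := by
  have hB : IsCompact (weakDualUnitBall 𝕜 Y) := WeakDual.isCompact_closedBall 0 1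
  have := isCompact_iff_compactSpace.1 hB
  have := WeakDual.metrizable_of_isCompact 𝕜 Y _ hB
  let _ := metrizableSpaceMetric (weakDualUnitBall 𝕜 Y)
  infer_instance

/-- The restriction of the adjoint of `T` to the dual unit ball. -/
noncomputable def adjointOnBall (T : X →L[𝕜] Y) (b : weakDualUnitBall 𝕜 Y) : StrongDual 𝕜 X :=
  WeakDual.toStrongDual b.1 ∘L T

theorem hasSeparableAdjointRange_of_isSeparable_range_adjointOnBall {T : X →L[𝕜] Y}
    (h : IsSeparable (Set.range (adjointOnBall T))) : HasSeparableAdjointRange T := by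
  refine isSeparable_range_of_isSeparable_image_closedBall
    ((ContinuousLinearMap.compL 𝕜 X Y 𝕜).flip T).toLinearMap (h.mono ?_)
  rintro _ ⟨f, hf, rfl⟩
  exact ⟨⟨StrongDual.toWeakDual f, hf⟩, rfl⟩

end Functionals

/-! ### Enumerating the tree -/

namespace Omega

/-- The empty sequence. -/
def root : Omega := ([] : List ℕ)

/-- The immediate predecessor of a non-empty sequence; the empty sequence is its own parent. -/
def parent (s : Omega) : Omega := List.dropLast s

/-- An enumeration of the finite sequences in which parents come first. The pairing function that
encodes lists of natural numbers increases along tails, whence the reversal. -/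
def code : Omega ≃ ℕ :=
  (⟨List.reverse, List.reverse, List.reverse_reverse, List.reverse_reverse⟩ :
    List ℕ ≃ List ℕ).trans (Denumerable.eqv (List ℕ))

theorem root_le (s : Omega) : root ≤ s := List.nil_prefix

theorem le_root_iff {s : Omega} : s ≤ root ↔ s = root :=
  ⟨fun h => h.antisymm (root_le s), Eq.le⟩

theorem parent_le (s : Omega) : s.parent ≤ s := List.dropLast_prefix s

theorem le_iff_eq_or_le_parent {s t : Omega} (ht : t ≠ root) : s ≤ t ↔ s = t ∨ s ≤ t.parent := by
  have key : ∀ s t : List ℕ, t ≠ [] → (s <+: t ↔ s = t ∨ s <+: t.dropLast) := fun s t ht => by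
    conv_lhs => rw [← List.dropLast_append_getLast ht]
    rw [List.prefix_concat_iff, List.dropLast_append_getLast ht]
  exact key s t ht

theorem code_root : code root = 0 := rfl

theorem code_parent_lt {s : Omega} (hs : s ≠ root) : code s.parent < code s := by
  have key : ∀ s : List ℕ, s ≠ [] →
      Encodable.encode s.dropLast.reverse < Encodable.encode s.reverse := fun s hs => by
    conv_rhs => rw [← List.dropLast_append_getLast hs]
    rw [List.reverse_append, List.reverse_singleton, List.singleton_append,
      Encodable.encode_list_cons]
    exact Nat.lt_succ_of_le (Nat.right_le_pair _ _)
  exact key s hs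

theorem ne_root_of_code_lt {s t : Omega} (h : code s < code t) : t ≠ root := by
  rintro rfl
  exact h.not_ge (code_root ▸ Nat.zero_le _)

theorem parent_induction {P : Omega → Prop} (root : P root)
    (of_parent : ∀ t, t ≠ Omega.root → P t.parent → P t) (t : Omega) : P t := by
  induction t using (measure code).wf.induction with
  | _ t ih =>
    by_cases ht : t = Omega.root
    · exact ht ▸ root
    · exact of_parent t ht (ih _ (code_parent_lt ht))

theorem code_le_code {s t : Omega} (h : s ≤ t) : code s ≤ code t := by
  induction t using parent_induction with
  | root => rw [le_root_iff.1 h]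
  | of_parent t ht ih =>
    rcases (le_iff_eq_or_le_parent ht).1 h with rfl | h
    · exact le_rfl
    · exact (ih h).trans (code_parent_lt ht).le

theorem not_le_parent {t : Omega} (ht : t ≠ root) : ¬ t ≤ t.parent := fun h =>
  (code_le_code h).not_gt (code_parent_lt ht)

instance : Countable Omega := code.injective.countable

instance (s : Omega) : Finite {t // code t < code s} :=
  ((Set.finite_Iio (code s)).preimage code.injective.injOn).to_subtype

theorem norm_le_sum_of_norm_sub_parent_le {E : Type*} [SeminormedAddCommGroup E] {d : Omega → E}
    {a : ℕ → ℝ} {n : ℕ} (ha : ∀ k, 0 ≤ a k) (h₀ : ∀ t, code t ≤ n → d t = 0)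
    (h : ∀ t, n < code t → ‖d t - d t.parent‖ ≤ a (code t)) (t : Omega) :
    ‖d t‖ ≤ ∑ k ∈ Finset.Ioc n (code t), a k := by
  have hzero : ∀ t, code t ≤ n → ‖d t‖ ≤ ∑ k ∈ Finset.Ioc n (code t), a k := fun t ht => by
    simp [h₀ t ht, Finset.Ioc_eq_empty_of_le ht]
  induction t using parent_induction with
  | root => exact hzero root (code_root ▸ Nat.zero_le n)
  | of_parent t ht ih =>
    rcases le_or_gt (code t) n with hn | hn
    · exact hzero t hn
    have hmem : code t ∉ Finset.Ioc n (code t.parent) := fun hmem =>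
      (Finset.mem_Ioc.1 hmem).2.not_gt (code_parent_lt ht)
    calc ‖d t‖ ≤ ‖d t - d t.parent‖ + ‖d t.parent‖ := norm_le_norm_sub_add _ _
      _ ≤ a (code t) + ∑ k ∈ Finset.Ioc n (code t.parent), a k := add_le_add (h t hn) ih
      _ = ∑ k ∈ insert (code t) (Finset.Ioc n (code t.parent)), a k :=
        (Finset.sum_insert hmem).symm
      _ ≤ ∑ k ∈ Finset.Ioc n (code t), a k :=
        Finset.sum_le_sum_of_subset_of_nonneg
          (Finset.insert_subset (Finset.right_mem_Ioc.2 hn)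
            (Finset.Ioc_subset_Ioc_right (code_parent_lt ht).le)) fun k _ _ => ha k

end Omega

theorem exists_forall_of_wellFounded {ι α : Type*} {r : ι → ι → Prop} (hr : WellFounded r)
    {R : ∀ s, ({t // r t s} → α) → α → Prop} (h : ∀ s f, ∃ a, R s f a) :
    ∃ f : ι → α, ∀ s, R s (fun t => f t) (f s) := by
  choose F hF using h
  let f : ι → α := hr.fix fun s ih => F s fun t => ih t t.2
  have hf : ∀ s, f s = F s fun t => f t := hr.fix_eq _
  exact ⟨f, fun s => by conv => { arg 3; rw [hf s] }; exact hF s _⟩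

/-! ### Almost biorthogonal trees -/

section Trees

open Omega

variable {𝕜 : Type*} [RCLike 𝕜] {X Y : Type*}
  [NormedAddCommGroup X] [NormedSpace 𝕜 X] [NormedAddCommGroup Y] [NormedSpace 𝕜 Y]

/-- A tree of functionals whose increment at each node `s` is at most `ε / 2 ^ code s` on the
vectors `y t` with `t` before `s` in the enumeration. -/
def HasSmallIncrements (ε : ℝ) (β : Omega → StrongDual 𝕜 Y) (y : Omega → Y) : Prop :=
  ∀ s t, code t < code s → ‖β s (y t) - β s.parent (y t)‖ ≤ ε * (1 / 2) ^ code s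

/-- The matrix `β t (z s)`, with indices in the order of the enumeration, is triangular with unit
diagonal. -/
structure IsUnitriangular (β : Omega → StrongDual 𝕜 Y) (z : Omega → Y) : Prop where
  apply_self : ∀ s, β s (z s) = 1
  apply_of_code_lt : ∀ s t, code t < code s → β t (z s) = 0

theorem IsNowhereNearSeparable.exists_mem_apply_eq_one {T : X →L[𝕜] Y} {δ : ℝ} (hδ : 0 < δ)
    {A : Set (weakDualUnitBall 𝕜 Y)} (hA : IsNowhereNearSeparable (adjointOnBall T) δ A)
    {c : weakDualUnitBall 𝕜 Y} (hc : c ∈ A) {ι κ : Type*} [Finite ι] [Finite κ]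
    (L : ι → StrongDual 𝕜 X) (y : κ → Y) {r : ℝ} (hr : 0 < r) :
    ∃ a ∈ A, ∃ x, ‖x‖ ≤ δ⁻¹ ∧ a.1 (T x) = 1 ∧ (∀ i, L i x = 0) ∧
      ∀ k, ‖a.1 (y k) - c.1 (y k)‖ < r := by
  let U : Set (weakDualUnitBall 𝕜 Y) := ⋂ k, {a | ‖a.1 (y k) - c.1 (y k)‖ < r}
  have hU : IsOpen U := isOpen_iInter_of_finite fun k => isOpen_lt
    (((WeakDual.eval_continuous (y k)).comp continuous_subtype_val).sub continuous_const).norm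
    continuous_const
  have hcU : c ∈ U := Set.mem_iInter.2 fun k => by simpa using hr
  obtain ⟨a, ⟨haU, haA⟩, ha⟩ := hA U hU ⟨c, hcU, hc⟩ (Submodule.span 𝕜 (Set.range L))
    (Set.finite_range L).isSeparable.span
  obtain ⟨x, hx, hax, hLx⟩ := exists_apply_eq_one_of_forall_mem_span_lt L (adjointOnBall T a) hδ
    fun g hg => (ha g hg).trans_eq (dist_eq_norm _ _)
  exact ⟨a, haA, x, hx, hax, hLx, by simpa only [U, Set.mem_iInter, Set.mem_ofPred_eq] using haU⟩

theorem exists_isUnitriangular_hasSmallIncrements [SeparableSpace Y] {T : X →L[𝕜] Y}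
    (hT : ¬ HasSeparableAdjointRange T) (y : Omega → Y) {ε : ℝ} (hε : 0 < ε) :
    ∃ (C : ℝ) (x : Omega → X) (β : Omega → StrongDual 𝕜 Y),
      (∀ s, ‖x s‖ ≤ C) ∧ (∀ s, ‖β s‖ ≤ 1) ∧ IsUnitriangular β (fun s => T (x s)) ∧
      HasSmallIncrements ε β (fun s => T (x s)) ∧ HasSmallIncrements ε β y := by
  classical
  have hns : ¬ IsSeparable (Set.range (adjointOnBall T)) :=
    mt hasSeparableAdjointRange_of_isSeparable_range_adjointOnBall hT
  obtain ⟨δ, hδ, A, ⟨a₀, ha₀⟩, hA⟩ := exists_isNowhereNearSeparable hns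
  let pred (s : Omega) (f : {t // code t < code s} → A × X) : A :=
    if hs : s = root then ⟨a₀, ha₀⟩ else (f ⟨s.parent, code_parent_lt hs⟩).1
  let earlier (s : Omega) (f : {t // code t < code s} → A × X) :
      {t // code t < code s} ⊕ {t // code t < code s} → Y :=
    Sum.elim (fun t => T (f t).2) fun t => y t
  obtain ⟨f, hf⟩ := exists_forall_of_wellFounded (r := fun t s => code t < code s)
    (InvImage.wf code wellFounded_lt)
    (R := fun s f (a : A × X) => ‖a.2‖ ≤ δ⁻¹ ∧ a.1.1.1 (T a.2) = 1 ∧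
      (∀ t, (f t).1.1.1 (T a.2) = 0) ∧
      ∀ k, ‖a.1.1.1 (earlier s f k) - (pred s f).1.1 (earlier s f k)‖ < ε * (1 / 2) ^ code s)
    fun s f => by
      obtain ⟨a, haA, x, h⟩ := hA.exists_mem_apply_eq_one hδ (pred s f).2
        (fun t => adjointOnBall T (f t).1.1) (earlier s f) (r := ε * (1 / 2) ^ code s)
        (by positivity)
      exact ⟨⟨⟨a, haA⟩, x⟩, h⟩
  choose hx h_self h_lt h_inc using hf
  have h_small : ∀ s, s ≠ root → ∀ k, ‖(f s).1.1.1 (earlier s (fun t => f t) k) -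
      (f s.parent).1.1.1 (earlier s (fun t => f t) k)‖ ≤ ε * (1 / 2) ^ code s := fun s hs k => by
    have h_pred : pred s (fun t => f t) = (f s.parent).1 := dif_neg hs
    rw [← h_pred]
    exact (h_inc s k).le
  exact ⟨δ⁻¹, fun s => (f s).2, fun s => WeakDual.toStrongDual (f s).1.1.1, hx,
    fun s => mem_closedBall_zero_iff.1 (f s).1.1.2, ⟨h_self, fun s t hst => h_lt s ⟨t, hst⟩⟩,
    fun s t hst => h_small s (ne_root_of_code_lt hst) (Sum.inl ⟨t, hst⟩),
    fun s t hst => h_small s (ne_root_of_code_lt hst) (Sum.inr ⟨t, hst⟩)⟩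

theorem sum_Ioc_one_half_pow_le (m n : ℕ) :
    ∑ k ∈ Finset.Ioc m n, (1 / 2 : ℝ) ^ k ≤ (1 / 2) ^ m := by
  have h := geom_sum_Ico_le_of_lt_one (x := (1 / 2 : ℝ)) (m := m + 1) (n := n + 1)
    (by norm_num) (by norm_num)
  rw [Finset.Ico_add_one_add_one_eq_Ioc] at h
  exact h.trans_eq (by ring)

open Classical in
theorem IsUnitriangular.norm_apply_sub_indicator_le {β : Omega → StrongDual 𝕜 Y} {z : Omega → Y}
    (hβz : IsUnitriangular β z) {ε : ℝ} (hε : 0 ≤ ε) (h : HasSmallIncrements ε β z)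
    (s t : Omega) : ‖β t (z s) - if s ≤ t then 1 else 0‖ ≤ ε * (1 / 2) ^ code s := by
  have h_le : ∀ t, code t ≤ code s → β t (z s) - (if s ≤ t then 1 else 0) = 0 := fun t ht => by
    rcases ht.eq_or_lt with ht | ht
    · rw [code.injective ht, hβz.apply_self, if_pos le_rfl, sub_self]
    · rw [hβz.apply_of_code_lt s t ht, if_neg fun hst => (code_le_code hst).not_gt ht, sub_zero]
  have h_step : ∀ t, code s < code t →
      ‖(β t (z s) - if s ≤ t then 1 else 0) -
        (β t.parent (z s) - if s ≤ t.parent then 1 else 0)‖ ≤ ε * (1 / 2) ^ code t :=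
    fun t ht => by
      have hiff : s ≤ t ↔ s ≤ t.parent := by
        rw [le_iff_eq_or_le_parent (ne_root_of_code_lt ht),
          or_iff_right fun hst => ht.ne (congrArg code hst)]
      simpa only [hiff, sub_sub_sub_cancel_right] using h t s ht
  calc _ ≤ ∑ k ∈ Finset.Ioc (code s) (code t), ε * (1 / 2) ^ k :=
        norm_le_sum_of_norm_sub_parent_le (fun k => by positivity) h_le h_step t
    _ ≤ ε * (1 / 2) ^ code s := by
      rw [← Finset.mul_sum]
      exact mul_le_mul_of_nonneg_left (sum_Ioc_one_half_pow_le _ _) hε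

end Trees

/-! ### Operators on `ℓ₁` and into `ℓ_∞` -/

section SequenceSpaces

variable {𝕜 : Type*} [RCLike 𝕜] {X : Type*} [NormedAddCommGroup X] [NormedSpace 𝕜 X] {I : Type*}

theorem EllOne.norm_eq_tsum (x : EllOne 𝕜 I) : ‖x‖ = ∑' i, ‖x i‖ := by
  simpa using lp.norm_eq_tsum_rpow (p := 1) (by simp) x

theorem EllOne.norm_smul_le_norm_mul {x : I → X} {C : ℝ} (hx : ∀ i, ‖x i‖ ≤ C) (a : EllOne 𝕜 I)
    (i : I) : ‖a i • x i‖ ≤ ‖a i‖ * C :=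
  (norm_smul _ _).trans_le (mul_le_mul_of_nonneg_left (hx i) (norm_nonneg _))

theorem EllOne.summable_smul [CompleteSpace X] {x : I → X} {C : ℝ} (hx : ∀ i, ‖x i‖ ≤ C)
    (a : EllOne 𝕜 I) : Summable fun i => a i • x i :=
  .of_norm_bounded ((EllOne.summable_norm a).mul_right C) (EllOne.norm_smul_le_norm_mul hx a)

/-- The operator on `ℓ₁(I)` mapping the unit vectors to a given bounded family. -/
noncomputable def EllOne.lift [CompleteSpace X] (x : I → X) (C : ℝ) (hx : ∀ i, ‖x i‖ ≤ C) :
    EllOne 𝕜 I →L[𝕜] X :=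
  LinearMap.mkContinuous
    { toFun := fun a => ∑' i, a i • x i
      map_add' := fun a b => by
        rw [← (EllOne.summable_smul hx a).tsum_add (EllOne.summable_smul hx b)]
        exact tsum_congr fun i => add_smul _ _ _
      map_smul' := fun c a => by
        rw [RingHom.id_apply, ← (EllOne.summable_smul hx a).tsum_const_smul c]
        exact tsum_congr fun i => smul_assoc c (a i) (x i) }
    C fun a => by
      rw [EllOne.norm_eq_tsum, mul_comm, ← tsum_mul_right]
      exact tsum_of_norm_bounded ((EllOne.summable_norm a).mul_right C).hasSum
        (EllOne.norm_smul_le_norm_mul hx a)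

theorem EllOne.lift_single [DecidableEq I] [CompleteSpace X] (x : I → X) (C : ℝ)
    (hx : ∀ i, ‖x i‖ ≤ C) (i : I) : EllOne.lift x C hx (lp.single 1 i (1 : 𝕜)) = x i := by
  change ∑' j, (lp.single 1 i (1 : 𝕜) : EllOne 𝕜 I) j • x j = x i
  rw [tsum_eq_single i fun j hj => by rw [lp.single_apply_ne _ _ _ hj, zero_smul],
    lp.single_apply_self, one_smul]

theorem EllOne.ext_single [DecidableEq I] {f g : EllOne 𝕜 I →L[𝕜] X}
    (h : ∀ i, f (lp.single 1 i 1) = g (lp.single 1 i 1)) : f = g :=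
  lp.ext_continuousLinearMap (by simp) fun i => ContinuousLinearMap.ext_ring (h i)

instance [Countable I] : SeparableSpace (EllOne 𝕜 I) := by
  classical
  let e (i : I) : EllOne 𝕜 I := lp.single 1 i 1
  have h_span : IsSeparable (closure (Submodule.span 𝕜 (Set.range e) : Set (EllOne 𝕜 I))) :=
    (Set.countable_range e).isSeparable.span.closure
  refine isSeparable_univ_iff.1 (h_span.mono fun x _ => ?_)
  refine mem_closure_of_tendsto (lp.hasSum_single (by simp) x) (.of_forall fun s =>
    Submodule.sum_mem _ fun i _ => ?_)
  have h_smul : lp.single 1 i (x i) = x i • e i := by rw [← lp.single_smul, smul_eq_mul, mul_one]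
  exact h_smul ▸ Submodule.smul_mem _ _ (Submodule.subset_span ⟨i, rfl⟩)

/-- The operator into `ℓ_∞(I)` whose coordinates are a given bounded family of functionals. -/
noncomputable def EllInfty.ofFunctionals (f : I → StrongDual 𝕜 X) (C : ℝ) (hf : ∀ i, ‖f i‖ ≤ C) :
    X →L[𝕜] EllInfty 𝕜 I :=
  have hle : ∀ x i, ‖f i x‖ ≤ max C 0 * ‖x‖ := fun x i =>
    (f i).le_of_opNorm_le ((hf i).trans (le_max_left _ _)) x
  LinearMap.mkContinuous
    { toFun := fun x => ⟨fun i => f i x, memℓp_infty ⟨_, Set.forall_mem_range.2 (hle x)⟩⟩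
      map_add' := fun x y => by ext i; exact map_add (f i) x y
      map_smul' := fun c x => by ext i; exact map_smul (f i) c x }
    (max C 0) fun x => lp.norm_le_of_forall_le (by positivity) (hle x)

/-- Hahn–Banach, coordinate by coordinate. -/
theorem EllInfty.exists_extension (p : Submodule 𝕜 X) (V : p →L[𝕜] EllInfty 𝕜 I) :
    ∃ V' : X →L[𝕜] EllInfty 𝕜 I, V' ∘L p.subtypeL = V := by
  let g (i : I) : StrongDual 𝕜 p := lp.evalCLM 𝕜 (fun _ : I => 𝕜) ∞ i ∘L V
  have hg : ∀ i, ‖g i‖ ≤ ‖V‖ := fun i =>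
    (g i).opNorm_le_bound (norm_nonneg V) fun x =>
      (lp.norm_apply_le_norm (by simp) (V x) i).trans (V.le_opNorm x)
  choose f hf hfn using fun i => exists_extension_norm_eq p (g i)
  refine ⟨EllInfty.ofFunctionals f ‖V‖ fun i => (hfn i).trans_le (hg i), ?_⟩
  ext x i
  exact hf i x

/-- Restriction of continuous functions to a family of points with dense range. -/
noncomputable def denseRestriction (𝕜 : Type*) [RCLike 𝕜] {K : Type*} [TopologicalSpace K]
    [CompactSpace K] {e : I → K} (he : DenseRange e) : C(K, 𝕜) →ₗᵢ[𝕜] EllInfty 𝕜 I where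
  toFun f := ⟨fun i => f (e i), memℓp_infty
    ⟨‖f‖, Set.forall_mem_range.2 fun i => f.norm_coe_le_norm (e i)⟩⟩
  map_add' _ _ := rfl
  map_smul' _ _ := rfl
  norm_map' f := by
    refine le_antisymm (lp.norm_le_of_forall_le (norm_nonneg f) fun i => f.norm_coe_le_norm (e i))
      ((ContinuousMap.norm_le f (norm_nonneg _)).2 fun a => ?_)
    exact he.induction_on (p := fun a => ‖f a‖ ≤ _) a
      (isClosed_le f.continuous.norm continuous_const) fun i =>
        lp.norm_apply_le_norm (E := fun _ : I => 𝕜) (p := ∞) (by simp) ⟨fun i => f (e i), _⟩ i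

end SequenceSpaces

/-! ### Perturbing and lifting operators -/

section Perturbation

variable {𝕜 : Type*} [RCLike 𝕜] {Y E F : Type*} [NormedAddCommGroup Y] [NormedSpace 𝕜 Y]
  [NormedAddCommGroup E] [NormedSpace 𝕜 E] [CompleteSpace E]
  [NormedAddCommGroup F] [NormedSpace 𝕜 F]

/-- If `P = ∑ φᵢ ⊗ (W - S) eᵢ`, then `W = (1 + P) S`, and `1 + P` is invertible. -/
theorem exists_comp_eq_of_tsum_lt_one {I : Type*} [DecidableEq I] {S W : EllOne 𝕜 I →L[𝕜] E}
    {φ : I → StrongDual 𝕜 E} (hφ : ∀ i j, φ i (S (lp.single 1 j 1)) = if i = j then 1 else 0)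
    {a : I → ℝ} (ha : Summable a) (ha_lt : ∑' i, a i < 1)
    (hWS : ∀ i, ‖φ i‖ * ‖W (lp.single 1 i 1) - S (lp.single 1 i 1)‖ ≤ a i) :
    ∃ Q : E →L[𝕜] E, Q ∘L W = S := by
  let r (i : I) : E := W (lp.single 1 i 1) - S (lp.single 1 i 1)
  let P : E →L[𝕜] E := ∑' i, (φ i).smulRight (r i)
  have hφr : ∀ i, ‖(φ i).smulRight (r i)‖ ≤ a i := fun i =>
    (ContinuousLinearMap.norm_smulRight_apply _ _).trans_le (hWS i)
  have hP : ‖-P‖ < 1 := (norm_neg P).trans_lt ((tsum_of_norm_bounded ha.hasSum hφr).trans_lt ha_lt)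
  have hPS : ∀ j, P (S (lp.single 1 j 1)) = r j := fun j => by
    have h_eval : HasSum (fun i => φ i (S (lp.single 1 j 1)) • r i) (P (S (lp.single 1 j 1))) :=
      (Summable.of_norm_bounded ha hφr).hasSum.mapL (ContinuousLinearMap.apply 𝕜 E _)
    have h_single := hasSum_single (f := fun i => φ i (S (lp.single 1 j 1)) • r i) j
      fun i hij => by rw [hφ, if_neg hij, zero_smul]
    rw [hφ, if_pos rfl, one_smul] at h_single
    exact h_eval.unique h_single
  have hW : (1 - -P) ∘L S = W := EllOne.ext_single fun j => by
    rw [sub_neg_eq_add]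
    exact (congrArg _ (hPS j)).trans (add_sub_cancel _ _)
  obtain ⟨Q, hQ⟩ := (isUnit_one_sub_of_norm_lt_one hP).exists_left_inv
  exact ⟨Q, by rw [← hW, ← ContinuousLinearMap.comp_assoc]; exact congrArg (· ∘L S) hQ⟩

theorem exists_linearIsometry_comp_eq (J : E →ₗᵢ[𝕜] F) {V₀ : Y →L[𝕜] F} {I : Type*} {y : I → Y}
    (hy : DenseRange y) (h : ∀ i, V₀ (y i) ∈ Set.range J) :
    ∃ V : Y →L[𝕜] E, ∀ z, J (V z) = V₀ z := by
  have h_range : ∀ z, V₀ z ∈ LinearMap.range J.toLinearMap := fun z =>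
    hy.induction_on (p := fun z => V₀ z ∈ Set.range J) z
      (J.isometry.isClosedEmbedding.isClosed_range.preimage V₀.continuous) h
  exact ⟨(J.equivRange.symm : _ →L[𝕜] E) ∘L V₀.codRestrict _ h_range, fun z =>
    congrArg Subtype.val (J.equivRange.apply_symm_apply ⟨V₀ z, h_range z⟩)⟩

end Perturbation

/-! ### The completed tree -/

section CompletedTree

variable {T : LowerSet Omega}

theorem finite_Iic (t : T) : (Set.Iic t).Finite :=
  ((Omega.finite_Iic t.1).preimage Subtype.val_injective.injOn).subset fun s hs =>
    (hs : s.1 ≤ t.1)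

namespace Completion

theorem denseRange_node : DenseRange (node : T → Completion T) := by
  intro a
  cases a with
  | node t => exact subset_closure ⟨t, rfl⟩
  | branch b =>
    have : Nonempty b.1 := b.2.2.nonempty.to_subtype
    have : IsDirectedOrder b.1 := ⟨fun s t => (b.2.1.1.total s.2 t.2).elim
      (fun h => ⟨t, h, le_rfl⟩) fun h => ⟨s, le_rfl, h⟩⟩
    let f : Ultrafilter b.1 := Ultrafilter.of Filter.atTop
    refine mem_closure_iff_ultrafilter.2 ⟨f.map fun s => node s.1,
      Ultrafilter.mem_map.2 (Filter.univ_mem' fun s => ⟨s.1, rfl⟩),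
      le_nhds_of_forall _ _ fun s => ⟨fun hs => ?_, fun hs => ?_⟩⟩
    · exact Ultrafilter.of_le _ (Filter.mem_atTop (⟨s, hs⟩ : b.1))
    · obtain ⟨t, ht⟩ := Filter.nonempty_of_mem (f := (f : Filter b.1)) hs
      exact boundary.mem_of_le b.2 ht t.2

instance : SecondCountableTopology (Completion T) := by
  have h_countable : (⋃ t : T, {Set.Ici (node t), (Set.Ici (node t))ᶜ}).Countable :=
    Set.countable_iUnion fun t => (Set.toFinite _).countable
  refine ⟨⟨_, h_countable.mono ?_, rfl⟩⟩
  rintro U ⟨a, ha, hU⟩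
  obtain ⟨t, rfl⟩ := (isNonLimit_iff a).1 ha
  exact Set.mem_iUnion.2 ⟨t, hU⟩

theorem le_of_forall_node_le : ∀ {a b : Completion T}, (∀ s, node s ≤ a → node s ≤ b) → a ≤ b
  | node s, _, h => h s le_rfl
  | branch b, node t, h => absurd ((finite_Iic t).subset h) b.2.2
  | branch b, branch c, h => Subtype.ext (b.2.1.2 c.2.1.1 h)

theorem exists_node_le_and_not_node_le {a b : Completion T} (h : ¬ a ≤ b) :
    ∃ s, node s ≤ a ∧ ¬ node s ≤ b := by
  by_contra! h'
  exact h (le_of_forall_node_le h')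

instance : TotallySeparatedSpace (Completion T) := by
  refine totallySeparatedSpace_iff_exists_isClopen.2 fun a b hab => ?_
  rcases not_and_or.1 (mt le_antisymm_iff.2 hab) with h | h
  · obtain ⟨s, hsa, hsb⟩ := exists_node_le_and_not_node_le h
    exact ⟨_, isClopen_Ici_node s, hsa, hsb⟩
  · obtain ⟨s, hsb, hsa⟩ := exists_node_le_and_not_node_le h
    exact ⟨_, (isClopen_Ici_node s).compl, hsa, not_not_intro hsb⟩

end Completion

end CompletedTree

/-! ### Increments along the tree -/

section Increments

variable {T : LowerSet Omega}

/-- The immediate predecessor in a downwards closed tree; the root is its own parent. -/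
def treeParent (t : T) : T := ⟨t.1.parent, T.lower t.1.parent_le t.2⟩

theorem Iic_of_eq_root {t : T} (ht : t.1 = Omega.root) : Set.Iic t = {t} := by
  ext s
  rw [Set.mem_Iic, ← Subtype.coe_le_coe, ht, Omega.le_root_iff, ← ht, Set.mem_singleton_iff,
    Subtype.ext_iff]

theorem Iic_of_ne_root {t : T} (ht : t.1 ≠ Omega.root) :
    Set.Iic t = {t} ∪ Set.Iic (treeParent t) := by
  ext s
  rw [Set.mem_Iic, ← Subtype.coe_le_coe, Omega.le_iff_eq_or_le_parent ht, ← Subtype.ext_iff]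
  rfl

theorem not_le_treeParent {t : T} (ht : t.1 ≠ Omega.root) : ¬ t ≤ treeParent t :=
  Omega.not_le_parent ht

section AddCommGroup

variable {M : Type*} [AddCommGroup M]

open Classical in
/-- The increment of a function on a tree from the parent of a node to the node. A fictitious value
`0` below the root makes the increment at the root the value there. -/
noncomputable def increment (g : T → M) (t : T) : M :=
  g t - if t.1 = Omega.root then 0 else g (treeParent t)

theorem increment_of_eq_root (g : T → M) {t : T} (ht : t.1 = Omega.root) :
    increment g t = g t := by
  rw [increment, if_pos ht, sub_zero]

theorem increment_of_ne_root (g : T → M) {t : T} (ht : t.1 ≠ Omega.root) :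
    increment g t = g t - g (treeParent t) := by
  rw [increment, if_neg ht]

theorem map_increment {N F : Type*} [AddCommGroup N] [FunLike F M N] [AddMonoidHomClass F M N]
    (φ : F) (g : T → M) (t : T) : φ (increment g t) = increment (fun s => φ (g s)) t := by
  by_cases ht : t.1 = Omega.root
  · rw [increment_of_eq_root _ ht, increment_of_eq_root _ ht]
  · rw [increment_of_ne_root _ ht, increment_of_ne_root _ ht, map_sub]

theorem tsum_Iic_increment [TopologicalSpace M] [T2Space M] [ContinuousAdd M] (g : T → M) (t : T) :
    ∑' s : Set.Iic t, increment g s = g t := by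
  obtain ⟨t, ht⟩ := t
  induction t using Omega.parent_induction with
  | root =>
    rw [Iic_of_eq_root (t := ⟨_, ht⟩) rfl, tsum_singleton, increment_of_eq_root g rfl]
  | of_parent t hr ih =>
    have h_parent : ∑' s : Set.Iic (treeParent ⟨t, ht⟩), increment g s = g (treeParent ⟨t, ht⟩) :=
      ih _
    have h_disjoint : Disjoint {⟨t, ht⟩} (Set.Iic (treeParent ⟨t, ht⟩)) :=
      Set.disjoint_singleton_left.2 (not_le_treeParent (t := ⟨t, ht⟩) hr)
    rw [Iic_of_ne_root (t := ⟨t, ht⟩) hr, Summable.tsum_union_disjoint h_disjoint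
      ((Set.finite_singleton _).summable _) ((finite_Iic _).summable _), tsum_singleton, h_parent,
      increment_of_ne_root g hr, sub_add_cancel]

end AddCommGroup

theorem norm_increment_le {E : Type*} [SeminormedAddCommGroup E] {g : T → E} {C : ℝ}
    (hg : ∀ s, ‖g s‖ ≤ C) (t : T) : ‖increment g t‖ ≤ 2 * C := by
  have hC : 0 ≤ C := (norm_nonneg _).trans (hg t)
  refine (norm_sub_le _ _).trans ((add_le_add (hg t) ?_).trans_eq (two_mul C).symm)
  split_ifs
  · exact norm_zero.trans_le hC
  · exact hg _

open Classical in
theorem increment_indicator_Ici {R : Type*} [Ring R] (s t : T) :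
    increment (fun t => if s ≤ t then (1 : R) else 0) t = if s = t then 1 else 0 := by
  by_cases ht : t.1 = Omega.root
  · have h_root : s ≤ t ↔ s = t := by
      rw [← Set.mem_Iic, Iic_of_eq_root ht, Set.mem_singleton_iff]
    simp only [increment_of_eq_root _ ht, h_root]
  · have h_step : s ≤ t ↔ s = t ∨ s ≤ treeParent t := by
      rw [← Set.mem_Iic, Iic_of_ne_root ht]
      rfl
    rw [increment_of_ne_root _ ht]
    obtain rfl | hst := eq_or_ne s t
    · rw [if_pos le_rfl, if_neg (not_le_treeParent ht), sub_zero, if_pos rfl]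
    · simp only [h_step, hst, false_or, sub_self, if_false]

end Increments

/-! ### The summation operators -/

section Sigma

variable {𝕜 : Type*} [RCLike 𝕜] {T : LowerSet Omega}

/-- The isometric embedding of `C(T ∪ ∂T)` into `ℓ_∞(T)` by restriction to the nodes. -/
noncomputable def nodeRestriction (𝕜 : Type*) [RCLike 𝕜] (T : LowerSet Omega) :
    C(Completion T, 𝕜) →ₗᵢ[𝕜] EllInfty 𝕜 T :=
  denseRestriction 𝕜 Completion.denseRange_node

open Classical in
theorem smallSigma_single (s : T) (a : Completion T) :
    smallSigma 𝕜 T (lp.single 1 s 1) a = if .node s ≤ a then 1 else 0 := by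
  change ∑' r : {r : T | .node r ≤ a}, (lp.single 1 s (1 : 𝕜) : EllOne 𝕜 T) r = _
  rw [tsum_subtype _ fun r => (lp.single 1 s (1 : 𝕜) : EllOne 𝕜 T) r, tsum_eq_single s]
  · rw [Set.indicator_apply, lp.single_apply_self]
    rfl
  · intro r hr
    rw [Set.indicator_apply, lp.single_apply_ne _ _ _ hr, ite_self]

theorem mem_range_nodeRestriction {g : EllInfty 𝕜 T} (hg : Summable fun t => ‖increment g t‖) :
    g ∈ Set.range (nodeRestriction 𝕜 T) := by
  refine ⟨smallSigma 𝕜 T ⟨increment g, memℓp_gen (by simpa using hg)⟩, ?_⟩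
  ext t
  exact tsum_Iic_increment g t

/-- The increment at a node, as a functional on `C(T ∪ ∂T)`. These functionals are biorthogonal to
the images of the unit vectors under the summation operator. -/
noncomputable def incrementCLM (𝕜 : Type*) [RCLike 𝕜] (t : T) : StrongDual 𝕜 C(Completion T, 𝕜) :=
  increment (fun t => ContinuousMap.evalCLM 𝕜 (.node t)) t

theorem norm_incrementCLM_le (t : T) : ‖incrementCLM 𝕜 t‖ ≤ 2 := by
  have h_eval : ∀ s : T,
      ‖(ContinuousMap.evalCLM 𝕜 (.node s) : StrongDual 𝕜 C(Completion T, 𝕜))‖ ≤ 1 := fun s =>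
    ContinuousLinearMap.opNorm_le_bound _ zero_le_one fun f =>
      (f.norm_coe_le_norm _).trans_eq (one_mul _).symm
  exact (norm_increment_le h_eval t).trans_eq (mul_one 2)

theorem incrementCLM_apply (t : T) (f : C(Completion T, 𝕜)) :
    incrementCLM 𝕜 t f = increment (fun s => f (.node s)) t :=
  map_increment (ContinuousLinearMap.apply 𝕜 𝕜 f)
    (fun s : T => (ContinuousMap.evalCLM 𝕜 (.node s) : StrongDual 𝕜 C(Completion T, 𝕜))) t

open Classical in
theorem incrementCLM_smallSigma_single (t s : T) :
    incrementCLM 𝕜 t (smallSigma 𝕜 T (lp.single 1 s 1)) = if t = s then 1 else 0 := by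
  simp only [incrementCLM_apply, smallSigma_single, Completion.node_le_node,
    increment_indicator_Ici, eq_comm (a := s)]

end Sigma

/-! ### Factoring the summation operators -/

section Factorization

variable {𝕜 : Type*} [RCLike 𝕜] {X Y : Type*}
  [NormedAddCommGroup X] [NormedSpace 𝕜 X] [NormedAddCommGroup Y] [NormedSpace 𝕜 Y]

theorem injective_code_val (T : LowerSet Omega) :
    Function.Injective fun t : T => Omega.code t.1 :=
  Omega.code.injective.comp Subtype.val_injective

theorem summable_one_half_pow_code (T : LowerSet Omega) :
    Summable fun t : T => (1 / 2 : ℝ) ^ Omega.code t.1 :=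
  summable_geometric_two.comp_injective (injective_code_val T)

theorem tsum_one_half_pow_code_le (T : LowerSet Omega) :
    ∑' t : T, (1 / 2 : ℝ) ^ Omega.code t.1 ≤ 2 :=
  (tsum_comp_le_tsum_of_inj summable_geometric_two (fun _ => by positivity)
    (injective_code_val T)).trans_eq tsum_geometric_two

theorem HasSmallIncrements.summable_norm_increment {ε : ℝ} {β : Omega → StrongDual 𝕜 Y}
    {y : Omega → Y} (h : HasSmallIncrements ε β y) (T : LowerSet Omega) (r : Omega) :
    Summable fun t : T => ‖increment (fun t : T => β t (y r)) t‖ := by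
  refine .of_norm_bounded_eventually ((summable_one_half_pow_code T).mul_left ε) ?_
  have h_finite : {t : T | Omega.code t.1 ≤ Omega.code r}.Finite :=
    (Set.finite_Iic (Omega.code r)).preimage (injective_code_val T).injOn
  filter_upwards [h_finite.compl_mem_cofinite] with t ht
  have ht : Omega.code r < Omega.code t.1 := not_le.1 ht
  rw [norm_norm, increment_of_ne_root _ (Omega.ne_root_of_code_lt ht)]
  exact h t.1 r ht

theorem HasSmallIncrements.exists_apply_node_eq {ε C : ℝ} {β : Omega → StrongDual 𝕜 Y}
    {y : Omega → Y} (h : HasSmallIncrements ε β y) (hy : DenseRange y) (hβ : ∀ s, ‖β s‖ ≤ C)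
    (T : LowerSet Omega) :
    ∃ V : Y →L[𝕜] C(Completion T, 𝕜), ∀ (z : Y) (t : T), V z (.node t) = β t z := by
  let V₀ : Y →L[𝕜] EllInfty 𝕜 T := EllInfty.ofFunctionals (fun t => β t) C fun t => hβ t
  obtain ⟨V, hV⟩ := exists_linearIsometry_comp_eq (nodeRestriction 𝕜 T) (V₀ := V₀) hy fun r =>
    mem_range_nodeRestriction (h.summable_norm_increment T r)
  exact ⟨V, fun z t => congrArg (fun f : EllInfty 𝕜 T => f t) (hV z)⟩

theorem norm_le_of_forall_norm_node_le {T : LowerSet Omega} {f : C(Completion T, 𝕜)} {r : ℝ}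
    (hr : 0 ≤ r) (h : ∀ t, ‖f (.node t)‖ ≤ r) : ‖f‖ ≤ r :=
  ((nodeRestriction 𝕜 T).norm_map f).symm.trans_le (lp.norm_le_of_forall_le hr h)

open Classical in
theorem exists_comp_eq_smallSigma {T : LowerSet Omega} {W : EllOne 𝕜 T →L[𝕜] C(Completion T, 𝕜)}
    (hW : ∀ s, ‖W (lp.single 1 s 1) - smallSigma 𝕜 T (lp.single 1 s 1)‖ ≤
      1 / 8 * (1 / 2) ^ Omega.code s.1) :
    ∃ Q : C(Completion T, 𝕜) →L[𝕜] C(Completion T, 𝕜), Q ∘L W = smallSigma 𝕜 T := by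
  refine exists_comp_eq_of_tsum_lt_one incrementCLM_smallSigma_single
    ((summable_one_half_pow_code T).mul_left (2 * (1 / 8))) ?_ fun s => ?_
  · rw [tsum_mul_left]
    linarith [tsum_one_half_pow_code_le T]
  · rw [mul_assoc]
    exact mul_le_mul (norm_incrementCLM_le s) (hW s) (norm_nonneg _) zero_le_two

theorem factorsThrough_smallSigma [CompleteSpace X] [SeparableSpace Y] {T : X →L[𝕜] Y}
    (hT : ¬ HasSeparableAdjointRange T) (𝒯 : LowerSet Omega) :
    FactorsThrough (smallSigma 𝕜 𝒯) T := by
  classical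
  let y : Omega → Y := denseSeq Y ∘ Omega.code
  have hy : DenseRange y :=
    (denseRange_denseSeq Y).comp Omega.code.surjective.denseRange continuous_of_discreteTopology
  obtain ⟨C, x, β, hx, hβ, h_tri, h_inc, hy_inc⟩ :=
    exists_isUnitriangular_hasSmallIncrements hT y (ε := 1 / 8) (by norm_num)
  obtain ⟨V, hV⟩ := hy_inc.exists_apply_node_eq hy hβ 𝒯
  let U : EllOne 𝕜 𝒯 →L[𝕜] X := EllOne.lift (fun s => x s) C fun s => hx s
  have h_node : ∀ s t, (V ∘L T ∘L U) (lp.single 1 s 1) (.node t) = β t (T (x s)) := fun s t =>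
    (hV _ t).trans (congrArg (fun z => β t (T z)) (EllOne.lift_single _ C _ s))
  obtain ⟨Q, hQ⟩ := exists_comp_eq_smallSigma (W := V ∘L T ∘L U) fun s =>
    norm_le_of_forall_norm_node_le (by positivity) fun t => by
      rw [ContinuousMap.sub_apply, h_node, smallSigma_single]
      exact h_tri.norm_apply_sub_indicator_le (by norm_num) h_inc s.1 t.1
  exact ⟨U, Q ∘L V, hQ⟩

end Factorization

section Classes

variable {𝕜 : Type*} [RCLike 𝕜] {W Z X Y X' Y' : Type*}
  [NormedAddCommGroup W] [NormedSpace 𝕜 W] [NormedAddCommGroup Z] [NormedSpace 𝕜 Z]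
  [NormedAddCommGroup X] [NormedSpace 𝕜 X] [NormedAddCommGroup Y] [NormedSpace 𝕜 Y]
  [NormedAddCommGroup X'] [NormedSpace 𝕜 X'] [NormedAddCommGroup Y'] [NormedSpace 𝕜 Y']

theorem FactorsThrough.refl (T : X →L[𝕜] Y) : FactorsThrough T T :=
  ⟨ContinuousLinearMap.id 𝕜 X, ContinuousLinearMap.id 𝕜 Y, rfl⟩

theorem FactorsThrough.trans {R : W →L[𝕜] Z} {S : X' →L[𝕜] Y'} {T : X →L[𝕜] Y}
    (h₁ : FactorsThrough R S) (h₂ : FactorsThrough S T) : FactorsThrough R T := by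
  obtain ⟨U, V, rfl⟩ := h₁
  obtain ⟨U', V', rfl⟩ := h₂
  exact ⟨U' ∘L U, V ∘L V', rfl⟩

theorem FactorsThrough.comp_left (V : Y →L[𝕜] Z) (T : X →L[𝕜] Y) : FactorsThrough (V ∘L T) T :=
  ⟨ContinuousLinearMap.id 𝕜 X, V, rfl⟩

theorem FactorsThrough.comp_right (T : X →L[𝕜] Y) (U : W →L[𝕜] X) : FactorsThrough (T ∘L U) T :=
  ⟨U, ContinuousLinearMap.id 𝕜 Y, rfl⟩

theorem bigSigma_factorsThrough_smallSigma (𝒯 : LowerSet Omega) :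
    FactorsThrough (bigSigma 𝕜 𝒯) (smallSigma 𝕜 𝒯) :=
  .comp_left (nodeRestriction 𝕜 𝒯).toContinuousLinearMap _

theorem HasSeparableAdjointRange.of_factorsThrough {S : W →L[𝕜] Z} {T : X →L[𝕜] Y}
    (hT : HasSeparableAdjointRange T) (h : FactorsThrough S T) : HasSeparableAdjointRange S := by
  obtain ⟨U, V, rfl⟩ := h
  have h_cont : Continuous fun f : StrongDual 𝕜 X => (f ∘L U : StrongDual 𝕜 W) :=
    continuous_id.clm_comp continuous_const
  refine (IsSeparable.image hT h_cont).mono ?_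
  rintro _ ⟨f, rfl⟩
  exact ⟨_, ⟨f ∘L V, rfl⟩, rfl⟩

/-- By Hahn–Banach, every functional on `Y` is the restriction along `J` of one on `Z`. -/
theorem HasSeparableAdjointRange.of_linearIsometry_comp {T : X →L[𝕜] Y} (J : Y →ₗᵢ[𝕜] Z)
    (h : HasSeparableAdjointRange (J.toContinuousLinearMap ∘L T)) :
    HasSeparableAdjointRange T := by
  refine IsSeparable.mono h ?_
  rintro _ ⟨f, rfl⟩
  obtain ⟨g, hg, -⟩ := exists_extension_norm_eq (LinearMap.range J.toLinearMap)
    (f ∘L (J.equivRange.symm : _ →L[𝕜] Y))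
  refine ⟨g, ContinuousLinearMap.ext fun x => (hg (J.equivRange (T x))).trans ?_⟩
  exact congrArg f (J.equivRange.symm_apply_apply (T x))

theorem HasSeparableAdjointRange.isAsplund {T : X →L[𝕜] Y} (hT : HasSeparableAdjointRange T) :
    IsAsplund T :=
  fun Z _ _ => hT.of_factorsThrough (.comp_right T Z.subtypeL)

theorem IsAsplund.hasSeparableAdjointRange_comp [SeparableSpace W] {T : X →L[𝕜] Y}
    (hT : IsAsplund T) (U : W →L[𝕜] X) : HasSeparableAdjointRange (T ∘L U) := by
  let R : Submodule 𝕜 X := (LinearMap.range (U : W →ₗ[𝕜] X)).topologicalClosure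
  have hR : IsSeparable (R : Set X) := (isSeparable_range U.continuous).closure
  let U' : W →L[𝕜] R := U.codRestrict R fun w => Submodule.le_topologicalClosure _ ⟨w, rfl⟩
  exact (hT R (Submodule.isClosed_topologicalClosure _) hR.separableSpace).of_factorsThrough
    (.comp_right (T ∘L R.subtypeL) U')

theorem FactorsThrough.not_isAsplund [SeparableSpace W] {S : W →L[𝕜] Z} {T : X →L[𝕜] Y}
    (h : FactorsThrough S T) (hS : ¬ HasSeparableAdjointRange S) : ¬ IsAsplund T := by
  intro hT
  obtain ⟨U, V, rfl⟩ := h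
  exact hS ((hT.hasSeparableAdjointRange_comp U).of_factorsThrough (.comp_left V (T ∘L U)))

/-- Factor the corestriction of `T` to its range, which is separable, and extend the left factor to
`Y` by injectivity of `ℓ_∞`. -/
theorem factorsThrough_bigSigma_of_separableSpace [CompleteSpace X] [SeparableSpace X]
    {T : X →L[𝕜] Y} (hT : ¬ HasSeparableAdjointRange T) (𝒯 : LowerSet Omega) :
    FactorsThrough (bigSigma 𝕜 𝒯) T := by
  let R : Submodule 𝕜 Y := LinearMap.range (T : X →ₗ[𝕜] Y)
  have hR : IsSeparable (R : Set Y) := isSeparable_range T.continuous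
  have := hR.separableSpace
  let T₀ : X →L[𝕜] R := T.codRestrict R fun x => ⟨x, rfl⟩
  have hT₀ : ¬ HasSeparableAdjointRange T₀ := fun h =>
    hT (h.of_factorsThrough (.comp_left R.subtypeL T₀))
  obtain ⟨U, V, hUV⟩ :=
    (bigSigma_factorsThrough_smallSigma 𝒯).trans (factorsThrough_smallSigma hT₀ 𝒯)
  obtain ⟨V', rfl⟩ := EllInfty.exists_extension R V
  exact ⟨U, V', hUV⟩

theorem factorsThrough_bigSigma_of_not_isAsplund [CompleteSpace X] {T : X →L[𝕜] Y}
    (hT : ¬ IsAsplund T) (𝒯 : LowerSet Omega) : FactorsThrough (bigSigma 𝕜 𝒯) T := by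
  simp only [IsAsplund, not_forall] at hT
  obtain ⟨Z, hZ, _, hTZ⟩ := hT
  have : CompleteSpace Z := hZ.completeSpace_coe
  exact (factorsThrough_bigSigma_of_separableSpace hTZ 𝒯).trans (.comp_right T Z.subtypeL)

end Classes

/-! ### Trees with uncountably many branches -/

theorem countable_of_isSeparable_range_of_le_dist {ι M : Type*} [PseudoMetricSpace M] {f : ι → M}
    (hf : IsSeparable (Set.range f)) {r : ℝ} (hr : 0 < r)
    (h_dist : Pairwise fun i j => r ≤ dist (f i) (f j)) : Countable ι := by
  have := hf.separableSpace
  refine Pairwise.countable_of_isOpen_disjoint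
    (s := fun i => Metric.ball (Set.rangeFactorization f i) (r / 2))
    (fun i j hij => Metric.ball_disjoint_ball ?_) (fun _ => Metric.isOpen_ball)
    fun _ => Metric.nonempty_ball.2 (half_pos hr)
  rw [add_halves]
  exact h_dist hij

section Branches

variable (𝕜 : Type*) [RCLike 𝕜] {𝒮 : LowerSet Omega}

theorem one_le_dist_evalCLM_comp_smallSigma {a b : Completion 𝒮} (hab : ¬ a ≤ b) :
    1 ≤ dist (ContinuousMap.evalCLM 𝕜 a ∘L smallSigma 𝕜 𝒮)
      (ContinuousMap.evalCLM 𝕜 b ∘L smallSigma 𝕜 𝒮) := by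
  classical
  obtain ⟨s, hsa, hsb⟩ := Completion.exists_node_le_and_not_node_le hab
  let e : EllOne 𝕜 𝒮 := lp.single 1 s 1
  have he : ‖e‖ = 1 := (lp.norm_single zero_lt_one _ _).trans norm_one
  have h_eval : (ContinuousMap.evalCLM 𝕜 a ∘L smallSigma 𝕜 𝒮 -
      ContinuousMap.evalCLM 𝕜 b ∘L smallSigma 𝕜 𝒮) e = 1 := by
    change smallSigma 𝕜 𝒮 e a - smallSigma 𝕜 𝒮 e b = 1
    rw [smallSigma_single, smallSigma_single, if_pos hsa, if_neg hsb, sub_zero]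
  rw [dist_eq_norm, ← norm_one (α := 𝕜), ← h_eval]
  exact ContinuousLinearMap.unit_le_opNorm _ _ he.le

theorem not_hasSeparableAdjointRange_smallSigma (h𝒮 : ¬ (boundary 𝒮).Countable) :
    ¬ HasSeparableAdjointRange (smallSigma 𝕜 𝒮) := by
  intro h_sep
  refine h𝒮 (Set.countable_coe_iff.1 (countable_of_isSeparable_range_of_le_dist
    (f := fun b : boundary 𝒮 => ContinuousMap.evalCLM 𝕜 (.branch b) ∘L smallSigma 𝕜 𝒮)
    (IsSeparable.mono h_sep ?_) one_pos fun b c hbc => one_le_dist_evalCLM_comp_smallSigma 𝕜 hbc))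
  rintro _ ⟨b, rfl⟩
  exact ⟨_, rfl⟩

theorem not_hasSeparableAdjointRange_bigSigma (h𝒮 : ¬ (boundary 𝒮).Countable) :
    ¬ HasSeparableAdjointRange (bigSigma 𝕜 𝒮) := fun h =>
  not_hasSeparableAdjointRange_smallSigma 𝕜 h𝒮 (.of_linearIsometry_comp (nodeRestriction 𝕜 𝒮) h)

theorem universalityFor (𝕜 : Type w) [RCLike 𝕜] {𝒮 : LowerSet Omega}
    (h𝒮 : ¬ (boundary 𝒮).Countable) : UniversalityFor.{w, u, v} 𝕜 𝒮 := by
  have h_small := not_hasSeparableAdjointRange_smallSigma 𝕜 h𝒮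
  have h_big := not_hasSeparableAdjointRange_bigSigma 𝕜 h𝒮
  refine ⟨⟨(FactorsThrough.refl _).not_isAsplund h_big, ?_⟩, ⟨⟨h_small, inferInstance⟩, ?_⟩,
    ⟨(FactorsThrough.refl _).not_isAsplund h_small, inferInstance⟩, ?_⟩
  · intro X Y _ _ _ _ _ _ T hT
    exact factorsThrough_bigSigma_of_not_isAsplund hT 𝒮
  · intro X Y _ _ _ _ _ _ T hT _
    exact factorsThrough_smallSigma hT 𝒮
  · intro X Y _ _ _ _ _ _ T hT _
    exact factorsThrough_smallSigma (mt HasSeparableAdjointRange.isAsplund hT) 𝒮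

end Branches

section Boundary

variable {𝒮 : LowerSet Omega} {a b : ℕ → 𝒮}

theorem range_mem_boundary (h_mono : Monotone a) (ha : ∀ n, List.length (a n).1 = n) :
    Set.range a ∈ boundary 𝒮 := by
  have h_inj : Function.Injective a := fun m n h => by
    rw [← ha m, h, ha n]
  refine ⟨⟨h_mono.isChain_range, fun C hC haC => haC.antisymm fun t ht => ?_⟩,
    Set.infinite_range_of_injective h_inj⟩
  have h_length : List.length (a (List.length t.1)).1 = List.length t.1 := ha _
  refine ⟨List.length t.1, Subtype.ext ?_⟩
  rcases hC.total ht (haC ⟨List.length t.1, rfl⟩) with h | h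
  · exact (List.IsPrefix.eq_of_length h h_length.symm).symm
  · exact List.IsPrefix.eq_of_length h h_length

theorem eq_of_range_eq_of_length_eq (ha : ∀ n, List.length (a n).1 = n)
    (hb : ∀ n, List.length (b n).1 = n) (h : Set.range a = Set.range b) : a = b := by
  funext n
  obtain ⟨m, hm⟩ : a n ∈ Set.range b := h ▸ Set.mem_range_self n
  obtain rfl : m = n := by rw [← hb m, hm, ha]
  exact hm.symm

/-- The initial segments of a sequence of bits, as nodes of a tree containing the dyadic tree. -/
def bitSegment (h𝒮 : dyadicTree ≤ 𝒮) (x : Stream' Bool) (n : ℕ) : 𝒮 :=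
  ⟨(x.take n).map Bool.toNat, h𝒮 fun k hk => by
    obtain ⟨_ | _, -, rfl⟩ := List.mem_map.1 hk <;> simp⟩

theorem length_bitSegment (h𝒮 : dyadicTree ≤ 𝒮) (x : Stream' Bool) (n : ℕ) :
    List.length (bitSegment h𝒮 x n).1 = n :=
  List.length_map Bool.toNat |>.trans (x.length_take n)

theorem monotone_bitSegment (h𝒮 : dyadicTree ≤ 𝒮) (x : Stream' Bool) :
    Monotone (bitSegment h𝒮 x) :=
  fun m n hmn => (Stream'.take_prefix_take_left m n x hmn).map Bool.toNat

theorem injective_bitSegment (h𝒮 : dyadicTree ≤ 𝒮) : Function.Injective (bitSegment h𝒮) :=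
  fun x y h => Stream'.take_theorem x y fun n =>
    List.map_injective_iff.2 (by decide) (congrArg Subtype.val (congrFun h n))

theorem not_countable_boundary (h𝒮 : dyadicTree ≤ 𝒮) : ¬ (boundary 𝒮).Countable := by
  intro h_countable
  have := h_countable.to_subtype
  let branch : (ℕ → Bool) → boundary 𝒮 := fun x =>
    ⟨_, range_mem_boundary (monotone_bitSegment h𝒮 x) (length_bitSegment h𝒮 x)⟩
  have h_inj : Function.Injective branch := fun x y h => injective_bitSegment h𝒮
    (eq_of_range_eq_of_length_eq (length_bitSegment h𝒮 x) (length_bitSegment h𝒮 y)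
      (congrArg Subtype.val h))
  have h_uncountable : Uncountable (ℕ → Bool) :=
    Cardinal.aleph0_lt_mk_iff.1 (by simpa using Cardinal.cantor Cardinal.aleph0)
  exact not_countable h_inj.countable

end Boundary

end TreeOperators

theorem mainTheorem2_general (𝕜 : Type w) [RCLike 𝕜] :
    (∀ (X : Type u) (Y : Type v)
        [NormedAddCommGroup X] [NormedSpace 𝕜 X] [CompleteSpace X]
        [NormedAddCommGroup Y] [NormedSpace 𝕜 Y]
        (T : X →L[𝕜] Y), ¬ HasSeparableAdjointRange T → ∀ 𝒯 : LowerSet Omega,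
      (SeparableSpace X → FactorsThrough (bigSigma 𝕜 𝒯) T) ∧
      (SeparableSpace Y →
        FactorsThrough (smallSigma 𝕜 𝒯) T ∧ FactorsThrough (bigSigma 𝕜 𝒯) T)) ∧
    (∀ 𝒮 : LowerSet Omega, ¬ (boundary 𝒮).Countable → UniversalityFor.{w, u, v} 𝕜 𝒮) ∧
    (∀ (X : Type u) (Y : Type v)
        [NormedAddCommGroup X] [NormedSpace 𝕜 X] [CompleteSpace X]
        [NormedAddCommGroup Y] [NormedSpace 𝕜 Y]
        (T : X →L[𝕜] Y), SeparableSpace Y →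
      (¬ HasSeparableAdjointRange T ↔ ¬ IsAsplund T)) ∧
    ∀ 𝒮 : LowerSet Omega, dyadicTree ≤ 𝒮 → ¬ (boundary 𝒮).Countable := by
  refine ⟨?_, fun 𝒮 h𝒮 => universalityFor 𝕜 h𝒮, ?_, fun 𝒮 h𝒮 => not_countable_boundary h𝒮⟩
  · intro X Y _ _ _ _ _ T hT 𝒯
    refine ⟨fun _ => factorsThrough_bigSigma_of_separableSpace hT 𝒯, fun _ => ?_⟩
    have h_small : FactorsThrough (smallSigma 𝕜 𝒯) T := factorsThrough_smallSigma hT 𝒯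
    exact ⟨h_small, (bigSigma_factorsThrough_smallSigma 𝒯).trans h_small⟩
  · intro X Y _ _ _ _ _ T _
    refine ⟨fun hT => ?_, mt HasSeparableAdjointRange.isAsplund⟩
    exact (factorsThrough_smallSigma hT dyadicTree).not_isAsplund
      (not_hasSeparableAdjointRange_smallSigma 𝕜 (not_countable_boundary le_rfl))

theorem mainTheorem2 (𝕜 : Type w) [RCLike 𝕜] :
    (∀ (X : Type u) (Y : Type v)
        [NormedAddCommGroup X] [NormedSpace 𝕜 X] [CompleteSpace X]
        [NormedAddCommGroup Y] [NormedSpace 𝕜 Y] [CompleteSpace Y]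
        (T : X →L[𝕜] Y), ¬ HasSeparableAdjointRange T → ∀ 𝒯 : LowerSet Omega,
      (SeparableSpace X → FactorsThrough (bigSigma 𝕜 𝒯) T) ∧
      (SeparableSpace Y →
        FactorsThrough (smallSigma 𝕜 𝒯) T ∧ FactorsThrough (bigSigma 𝕜 𝒯) T)) ∧
    (∀ 𝒮 : LowerSet Omega, ¬ (boundary 𝒮).Countable →
      UniversalityFor.{w, u, v} 𝕜 𝒮) ∧
    (∀ (X : Type u) (Y : Type v)
        [NormedAddCommGroup X] [NormedSpace 𝕜 X] [CompleteSpace X]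
        [NormedAddCommGroup Y] [NormedSpace 𝕜 Y] [CompleteSpace Y]
        (T : X →L[𝕜] Y), SeparableSpace Y →
      (¬ HasSeparableAdjointRange T ↔ ¬ IsAsplund T)) ∧
    (¬ (boundary (⊤ : LowerSet Omega)).Countable ∧ UniversalityFor.{w, u, v} 𝕜 ⊤) ∧
    (¬ (boundary dyadicTree).Countable ∧ UniversalityFor.{w, u, v} 𝕜 dyadicTree) := by
  obtain ⟨h_factor, h_univ, h_iff, h_bd⟩ := mainTheorem2_general.{w, u, v} 𝕜
  exact ⟨fun X Y _ _ _ _ _ _ T => h_factor X Y T, h_univ, fun X Y _ _ _ _ _ _ T => h_iff X Y T,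
    ⟨h_bd ⊤ le_top, h_univ ⊤ (h_bd ⊤ le_top)⟩, h_bd _ le_rfl, h_univ _ (h_bd _ le_rfl)⟩
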